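/- Let $\mathcal H$ be a separable complex Hilbert space and let $\mathcal O$ be the category whose objects are the bounded self-adjoint operators on $\mathcal H$, with a (unique) morphism $f_{\mathcal O}:B\to A$ whenever $B=f(A)$ for some bounded Borel function $f$ (two functions $f,g$ being identified if $f(A)=g(A)$). For $\Delta$ a Borel subset of the spectrum $\sigma(A)$ let $E[A\in\Delta]$ be the spectral projector, let $W_A=\{E[A\in\Delta]\mid \Delta\subseteq\sigma(A)\text{ Borel}\}$, and for $f_{\mathcal O}:B\to A$ define $$E[B\in f(\Delta)]:=\inf\{E[B\in K]\mid K\subseteq\sigma(B)\text{ Borel},\ E[A\in\Delta]\le E[B\in K]\},$$ the infimum being taken in the lattice of all projectors on $\mathcal H$. A generalized valuation $\nu$ assigns to each proposition "$A\in\Delta$" ($A\in\mathcal O$, $\Delta\subseteq\sigma(A)$ Borel) a sieve $\nu(A\in\Delta)$ on $A$ in $\mathcal O$, depending only on $A$ and the projector $E[A\in\Delta]$, such that: (i) functional composition: for every $h_{\mathcal O}:h(A)\to A$ the projector $E[h(A)\in h(\Delta)]$ belongs to $W_{h(A)}$, and $\nu(h(A)\in h(\Delta))=h_{\mathcal O}^*(\nu(A\in\Delta))$,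 where the left side is $\nu(h(A)\in J)$ for any Borel $J\subseteq\sigma(h(A))$ with $E[h(A)\in J]=E[h(A)\in h(\Delta)]$, and $h_{\mathcal O}^*$ is the pull-back of sieves; (ii) null proposition: $\nu(A\in\emptyset)=\emptyset$; (iii) monotonicity: $\Delta_1\subseteq\Delta_2$ implies $\nu(A\in\Delta_1)\subseteq\nu(A\in\Delta_2)$; (iv) exclusivity: if $\Delta_1\cap\Delta_2=\emptyset$ and $\nu(A\in\Delta_1)$ is the principal sieve $\mathrm{true}_A$ of all morphisms into $A$, then $\nu(A\in\Delta_2)\subsetneq\mathrm{true}_A$. It satisfies the unit condition if $\nu(A\in\sigma(A))=\mathrm{true}_A$ for all $A$. Theorem. (a) For every density matrix $\rho$ (positive operator of trace $1$) the set $$\nu^\rho(A\in\Delta)=\{f_{\mathcal O}:B\to A\mid \operatorname{tr}(\rho\,E[B\in f(\Delta)])=1\}$$ is a sieve on $A$ in $\mathcal O$, and $\nu^\rho$ is a generalized valuation that satisfies the unit condition. (b) For every non-zero vector $\psi\in\mathcal H$ the set $$\nu^\psi(A\in\Delta)=\{f_{\mathcal O}:B\to A\mid E[B\in f(\Delta)]\psi=\psi\}$$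 is a sieve on $A$, $\nu^\psi$ is a generalized valuation that satisfies the unit condition, and $\nu^\psi=\nu^{\rho}$ for the density matrix $\rho=\|\psi\|^{-2}|\psi\rangle\langle\psi|$. Both valuations also satisfy the conditions in contextual form, as maps $\nu_A:W_A\to\{\text{sieves on }A\}$, $\nu_A(E[A\in\Delta])=\nu(A\in\Delta)$: functional composition; $\nu_A(0)=\emptyset$; $P\le Q$ implies $\nu_A(P)\subseteq\nu_A(Q)$; if $PQ=0$ and $\nu_A(P)=\mathrm{true}_A$ then $\nu_A(Q)\subsetneq\mathrm{true}_A$; $\nu_A(1)=\mathrm{true}_A$. -/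

import Mathlib

universe u

namespace GenVal

open MeasureTheory CategoryTheory InnerProductSpace
open scoped ENNReal

/-- `f` is a bounded Borel function on the line. -/
def IsBoundedBorel (f : ℝ → ℝ) : Prop :=
  Measurable f ∧ ∃ C : ℝ, ∀ x, |f x| ≤ C

theorem IsBoundedBorel.memLp {f : ℝ → ℝ} (hf : IsBoundedBorel f) (p : ℝ≥0∞)
    (μ : Measure ℝ) [IsFiniteMeasure μ] : MemLp f p μ := by
  obtain ⟨hm, C, hC⟩ := hf
  exact MemLp.of_bound hm.aestronglyMeasurable C (Filter.Eventually.of_forall hC)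

theorem IsBoundedBorel.mul {f h : ℝ → ℝ} (hf : IsBoundedBorel f) (hh : IsBoundedBorel h) :
    IsBoundedBorel (f * h) := by
  obtain ⟨hfm, C, hC⟩ := hf
  obtain ⟨hhm, D, hD⟩ := hh
  refine ⟨hfm.mul hhm, C * D, fun x => ?_⟩
  rw [Pi.mul_apply, abs_mul]
  exact mul_le_mul (hC x) (hD x) (abs_nonneg _) ((abs_nonneg _).trans (hC x))

theorem isBoundedBorel_one : IsBoundedBorel (1 : ℝ → ℝ) :=
  ⟨measurable_one, 1, fun _ => by simp⟩

theorem IsBoundedBorel.pow {f : ℝ → ℝ} (hf : IsBoundedBorel f) :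
    ∀ n : ℕ, IsBoundedBorel (f ^ n)
  | 0 => by simpa using isBoundedBorel_one
  | n + 1 => by
    rw [pow_succ]
    exact (hf.pow n).mul hf

/-- The objects of the category `𝒪`: bounded self-adjoint operators on the Hilbert space `H`. -/
structure Observable (H : Type u) [NormedAddCommGroup H] [InnerProductSpace ℂ H]
    [CompleteSpace H] where
  /-- the underlying operator -/
  op : H →L[ℂ] H
  isSelfAdjoint : IsSelfAdjoint op

namespace Observable

variable {H : Type u} [NormedAddCommGroup H] [InnerProductSpace ℂ H] [CompleteSpace H]

/-- The positive functional `g ↦ ⟨ψ, g(A) ψ⟩` on the continuous functions on the spectrum. -/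
noncomputable def functional (A : Observable H) (ψ : H) :
    CompactlySupportedContinuousMap (spectrum ℝ A.op) ℝ →ₚ[ℝ] ℝ :=
  PositiveLinearMap.mk₀
    { toFun := fun g => (inner ℂ ψ (cfcHom A.isSelfAdjoint g.toContinuousMap ψ)).re
      map_add' := fun g h => by
        have : (g + h).toContinuousMap = g.toContinuousMap + h.toContinuousMap := rfl
        simp [this, map_add]
      map_smul' := fun c g => by
        have : (c • g).toContinuousMap = c • g.toContinuousMap := rfl
        simp only [this, map_smul]
        simp [inner_smul_right_eq_smul] }
    (fun g hg => by
      have h0 : (0 : H →L[ℂ] H) ≤ cfcHom A.isSelfAdjoint g.toContinuousMap := by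
        rw [cfcHom_nonneg_iff]
        intro x
        exact hg x
      rw [ContinuousLinearMap.nonneg_iff_isPositive] at h0
      exact h0.re_inner_nonneg_right ψ)

/-- The spectral measure `μ^A_ψ = ⟨ψ, E^A(·) ψ⟩` of `A` in the vector `ψ`: the measure, carried by the
spectrum of `A`, that represents the functional `g ↦ ⟨ψ, g(A) ψ⟩` (Riesz-Markov-Kakutani). -/
noncomputable def spectralMeasure (A : Observable H) (ψ : H) : Measure ℝ :=
  (RealRMK.rieszMeasure (A.functional ψ)).map Subtype.val

instance (A : Observable H) (ψ : H) : IsFiniteMeasure (A.spectralMeasure ψ) := by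
  unfold spectralMeasure
  infer_instance

theorem spectralMeasure_compl_spectrum (A : Observable H) (ψ : H) :
    A.spectralMeasure ψ (spectrum ℝ A.op)ᶜ = 0 := by
  unfold spectralMeasure
  rw [Measure.map_apply measurable_subtype_coe (spectrum.isCompact _).measurableSet.compl]
  simp

theorem integral_spectralMeasure (A : Observable H) (ψ : H) {g : ℝ → ℝ} (hg : Continuous g) :
    ∫ x, g x ∂(A.spectralMeasure ψ) = (inner ℂ ψ (cfc g A.op ψ)).re := by
  unfold spectralMeasure
  rw [integral_map measurable_subtype_coe.aemeasurable hg.aestronglyMeasurable]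
  have := RealRMK.integral_rieszMeasure (A.functional ψ)
    ⟨⟨fun x => g x, by fun_prop⟩, HasCompactSupport.of_compactSpace _⟩
  rw [cfc_apply g A.op A.isSelfAdjoint]
  exact this


theorem ae_mem_spectrum (A : Observable H) (ψ : H) :
    ∀ᵐ x ∂(A.spectralMeasure ψ), x ∈ spectrum ℝ A.op :=
  A.spectralMeasure_compl_spectrum ψ

theorem memLp_of_continuous (A : Observable H) (ψ : H) {g : ℝ → ℝ} (hg : Continuous g)
    (p : ℝ≥0∞) : MemLp g p (A.spectralMeasure ψ) := by
  obtain ⟨C, hC⟩ := (spectrum.isCompact (𝕜 := ℝ) A.op).exists_bound_of_continuousOn hg.continuousOn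
  refine MemLp.of_bound hg.aestronglyMeasurable C ?_
  filter_upwards [A.ae_mem_spectrum ψ] with x hx using hC x hx

theorem enorm_cfc_apply (A : Observable H) (ψ : H) {g : ℝ → ℝ} (hg : Continuous g) :
    ‖cfc g A.op ψ‖ₑ = eLpNorm g 2 (A.spectralMeasure ψ) := by
  have h1 : ‖cfc g A.op ψ‖ ^ 2 = ∫ x, g x ^ 2 ∂(A.spectralMeasure ψ) := by
    rw [A.integral_spectralMeasure ψ (g := fun x => g x ^ 2) (by fun_prop), cfc_pow g 2 A.op hg.continuousOn A.isSelfAdjoint,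
      sq (cfc g A.op), mul_apply_eq_comp]
    have hs : IsSelfAdjoint (cfc g A.op) := cfc_predicate g A.op
    rw [← ContinuousLinearMap.adjoint_inner_left, hs.adjoint_eq, inner_self_eq_norm_sq_to_K]
    norm_cast
  have h2 := (A.memLp_of_continuous ψ hg 2).eLpNorm_eq_integral_rpow_norm (by norm_num) (by norm_num)
  rw [h2, ← ofReal_norm]
  congr 1
  simp only [ENNReal.toReal_ofNat, Real.rpow_ofNat, Real.norm_eq_abs, sq_abs]
  rw [← h1, ← one_div, ← Real.sqrt_eq_rpow, Real.sqrt_sq (norm_nonneg _)]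

theorem exists_continuous_approx {f : ℝ → ℝ} (hf : IsBoundedBorel f) (ν : Measure ℝ)
    [IsFiniteMeasure ν] {ε : ℝ≥0∞} (hε : ε ≠ 0) :
    ∃ g : ℝ → ℝ, Continuous g ∧ eLpNorm (f - g) 2 ν ≤ ε := by
  obtain ⟨g, hg, -⟩ := (hf.memLp 2 ν).exists_boundedContinuous_eLpNorm_sub_le (by norm_num) hε
  exact ⟨g, g.continuous, hg⟩

/-- Auxiliary: `v` is the vector `f(A) ψ`, the limit of the `g(A) ψ` with `g` continuous and `g → f` in
`L²(μ^A_ψ)`. -/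
def IsApply (A : Observable H) (f : ℝ → ℝ) (ψ v : H) : Prop :=
  ∀ g : ℝ → ℝ, Continuous g →
    ‖v - cfc g A.op ψ‖ₑ ≤ eLpNorm (f - g) 2 (A.spectralMeasure ψ)

theorem cfc_sub_apply (A : Observable H) (ψ : H) {g h : ℝ → ℝ} (hg : Continuous g)
    (hh : Continuous h) : cfc g A.op ψ - cfc h A.op ψ = cfc (g - h) A.op ψ := by
  have := cfc_sub g h A.op hg.continuousOn hh.continuousOn
  rw [show (g - h) = fun x => g x - h x from rfl, this]
  rfl

theorem exists_isApply (A : Observable H) {f : ℝ → ℝ} (hf : IsBoundedBorel f) (ψ : H) :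
    ∃ v, A.IsApply f ψ v := by
  set μ := A.spectralMeasure ψ with hμ
  have key : ∀ n : ℕ, ∃ g : ℝ → ℝ, Continuous g ∧ eLpNorm (f - g) 2 μ ≤ (1 / 2) / 2 ^ n :=
    fun n => exists_continuous_approx hf μ (by simp)
  choose g hgc hg using key
  have tri : ∀ (h k : ℝ → ℝ), Continuous h → Continuous k →
      eLpNorm (h - k) 2 μ ≤ eLpNorm (f - h) 2 μ + eLpNorm (f - k) 2 μ := by
    intro h k hh hk
    have hfm := hf.1.aestronglyMeasurable (μ := μ)
    have e : h - k = (f - k) - (f - h) := by ring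
    rw [e, add_comm]
    exact eLpNorm_sub_le (hfm.sub hk.aestronglyMeasurable) (hfm.sub hh.aestronglyMeasurable)
      (by norm_num)
  have hd : ∀ n, edist (cfc (g n) A.op ψ) (cfc (g (n + 1)) A.op ψ) ≤ 1 / 2 ^ n := by
    intro n
    rw [edist_eq_enorm_sub, A.cfc_sub_apply ψ (hgc n) (hgc _),
      A.enorm_cfc_apply ψ ((hgc n).sub (hgc _))]
    refine (tri _ _ (hgc n) (hgc _)).trans ?_
    calc _ ≤ (1 / 2 : ℝ≥0∞) / 2 ^ n + (1 / 2) / 2 ^ n := by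
            refine add_le_add (hg n) ((hg (n + 1)).trans ?_)
            exact ENNReal.div_le_div_left (pow_le_pow_right₀ (by norm_num) (Nat.le_succ n)) _
      _ = 1 / 2 ^ n := by rw [ENNReal.div_add_div_same, ENNReal.add_halves]
  obtain ⟨v, hv⟩ := cauchySeq_tendsto_of_complete (cauchySeq_of_edist_le_geometric_two 1
    ENNReal.one_ne_top hd)
  refine ⟨v, fun h hh => ?_⟩
  have lim : Filter.Tendsto (fun n => ‖v - cfc (g n) A.op ψ‖ₑ + ((1 / 2) / 2 ^ n
      + eLpNorm (f - h) 2 μ)) Filter.atTop (nhds (0 + (0 + eLpNorm (f - h) 2 μ))) := by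
    refine Filter.Tendsto.add ?_ (Filter.Tendsto.add ?_ tendsto_const_nhds)
    · have := (tendsto_const_nhds (x := v)).sub hv
      rw [sub_self] at this
      simpa using this.enorm
    · have : Filter.Tendsto (fun n : ℕ => (1 / 2 : ℝ≥0∞) * (2⁻¹) ^ n) Filter.atTop (nhds (1 / 2 * 0)) :=
        ENNReal.Tendsto.const_mul (ENNReal.tendsto_pow_atTop_nhds_zero_of_lt_one (by norm_num))
          (Or.inr (by norm_num))
      rw [mul_zero] at this
      refine this.congr fun n => ?_
      rw [div_eq_mul_inv (1 / 2 : ℝ≥0∞) (2 ^ n), ENNReal.inv_pow]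
  rw [zero_add, zero_add] at lim
  refine ge_of_tendsto' lim fun n => ?_
  calc ‖v - cfc h A.op ψ‖ₑ
      = ‖(v - cfc (g n) A.op ψ) + (cfc (g n) A.op ψ - cfc h A.op ψ)‖ₑ := by
        rw [sub_add_sub_cancel]
    _ ≤ _ := by
        refine (enorm_add_le _ _).trans ?_
        gcongr
        rw [A.cfc_sub_apply ψ (hgc n) hh, A.enorm_cfc_apply ψ ((hgc n).sub hh)]
        refine (tri _ _ (hgc n) hh).trans ?_
        gcongr
        exact hg n

theorem le_of_approx (A : Observable H) {f : ℝ → ℝ} (hf : IsBoundedBorel f) (a b c : H)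
    (r D K : ℝ≥0∞) (hK : K ≠ ∞)
    (h : ∀ g : ℝ → ℝ, Continuous g → r ≤ D + K * (eLpNorm (f - g) 2 (A.spectralMeasure a) +
      eLpNorm (f - g) 2 (A.spectralMeasure b) + eLpNorm (f - g) 2 (A.spectralMeasure c))) :
    r ≤ D := by
  set ν := A.spectralMeasure a + A.spectralMeasure b + A.spectralMeasure c with hν
  have hle : ∀ ε : ℝ≥0∞, ε ≠ 0 → r ≤ D + K * (ε + ε + ε) := by
    intro ε hε
    obtain ⟨g, hg, hgε⟩ := exists_continuous_approx hf ν hε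
    refine (h g hg).trans ?_
    gcongr
    · refine (eLpNorm_mono_measure _ ?_).trans hgε
      rw [hν, add_assoc]
      exact Measure.le_add_right le_rfl
    · refine (eLpNorm_mono_measure _ ?_).trans hgε
      rw [hν, add_assoc]
      exact Measure.le_add_left (Measure.le_add_right le_rfl)
    · refine (eLpNorm_mono_measure _ ?_).trans hgε
      exact Measure.le_add_left le_rfl
  have lim : Filter.Tendsto (fun n : ℕ => D + K * (((2 : ℝ≥0∞)⁻¹) ^ n + (2⁻¹) ^ n + (2⁻¹) ^ n))
      Filter.atTop (nhds (D + K * (0 + 0 + 0))) := by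
    have := ENNReal.tendsto_pow_atTop_nhds_zero_of_lt_one (r := (2 : ℝ≥0∞)⁻¹) (by norm_num)
    exact tendsto_const_nhds.add
      (ENNReal.Tendsto.const_mul ((this.add this).add this) (Or.inr hK))
  have h0 : r ≤ D + K * (0 + 0 + 0) :=
    ge_of_tendsto' lim fun n => hle _ (by simp)
  simpa using h0

theorem eq_zero_of_approx {E : Type*} [NormedAddCommGroup E] (A : Observable H) {f : ℝ → ℝ}
    (hf : IsBoundedBorel f) (a b c : H) (w : E) (K : ℝ≥0∞) (hK : K ≠ ∞)
    (h : ∀ g : ℝ → ℝ, Continuous g → ‖w‖ₑ ≤ K * (eLpNorm (f - g) 2 (A.spectralMeasure a) +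
      eLpNorm (f - g) 2 (A.spectralMeasure b) + eLpNorm (f - g) 2 (A.spectralMeasure c))) :
    w = 0 := by
  have h0 := A.le_of_approx hf a b c ‖w‖ₑ 0 K hK fun g hg => by
    rw [zero_add]
    exact h g hg
  simpa using h0

theorem IsApply.unique {A : Observable H} {f : ℝ → ℝ} (hf : IsBoundedBorel f) {ψ v w : H}
    (hv : A.IsApply f ψ v) (hw : A.IsApply f ψ w) : v = w := by
  rw [← sub_eq_zero]
  refine A.eq_zero_of_approx hf ψ ψ ψ _ 1 ENNReal.one_ne_top fun g hg => ?_
  rw [← sub_sub_sub_cancel_right v w (cfc g A.op ψ), one_mul]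
  exact (enorm_sub_le).trans ((add_le_add (hv g hg) (hw g hg)).trans le_self_add)

theorem eLpNorm_const_one (A : Observable H) (ψ : H) :
    eLpNorm (fun _ => (1 : ℝ)) 2 (A.spectralMeasure ψ) = ‖ψ‖ₑ := by
  rw [← A.enorm_cfc_apply ψ continuous_const, cfc_const_one ℝ A.op A.isSelfAdjoint]
  rfl

theorem IsApply.enorm_le {A : Observable H} {f : ℝ → ℝ} {ψ v : H}
    (hv : A.IsApply f ψ v) : ‖v‖ₑ ≤ eLpNorm f 2 (A.spectralMeasure ψ) := by
  have := hv (fun _ => 0) continuous_const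
  rw [cfc_const_zero] at this
  simpa [show f - (fun _ => (0 : ℝ)) = f from sub_zero f] using this

theorem exists_borelOp (A : Observable H) {f : ℝ → ℝ} (hf : IsBoundedBorel f) :
    ∃ T : H →L[ℂ] H, ∀ ψ, A.IsApply f ψ (T ψ) := by
  choose v hv using fun ψ => A.exists_isApply hf ψ
  obtain ⟨C, hC⟩ := hf.2
  let L : H →ₗ[ℂ] H :=
    { toFun := v
      map_add' := fun x y => by
        rw [← sub_eq_zero]
        refine A.eq_zero_of_approx hf (x + y) x y _ 1 ENNReal.one_ne_top fun g hg => ?_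
        rw [one_mul]
        have e : v (x + y) - (v x + v y) = (v (x + y) - cfc g A.op (x + y)) -
            (v x - cfc g A.op x) - (v y - cfc g A.op y) := by
          rw [map_add]; abel
        rw [e]
        exact enorm_sub_le.trans (add_le_add (enorm_sub_le.trans
          (add_le_add (hv _ g hg) (hv _ g hg))) (hv _ g hg))
      map_smul' := fun c x => by
        rw [← sub_eq_zero]
        refine A.eq_zero_of_approx hf (c • x) x x _ (1 + ‖c‖ₑ) (by simp) fun g hg => ?_
        have e : v (c • x) - (RingHom.id ℂ) c • v x = (v (c • x) - cfc g A.op (c • x)) -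
            c • (v x - cfc g A.op x) := by
          rw [map_smul, smul_sub]; simp
        rw [e]
        refine enorm_sub_le.trans ?_
        rw [enorm_smul, add_mul, one_mul]
        refine add_le_add ((hv _ g hg).trans ?_) (mul_le_mul_right ((hv _ g hg).trans ?_) _)
        · rw [add_assoc]; exact le_self_add
        · exact le_add_self }
  refine ⟨L.mkContinuous |C| fun ψ => ?_, fun ψ => hv ψ⟩
  have h1 : eLpNorm f 2 (A.spectralMeasure ψ) ≤ ENNReal.ofReal |C| * ‖ψ‖ₑ := by
    rw [← A.eLpNorm_const_one ψ]
    refine eLpNorm_le_mul_eLpNorm_of_ae_le_mul (Filter.Eventually.of_forall fun x => ?_) 2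
    simpa using (hC x).trans (le_abs_self C)
  have h2 := (hv ψ).enorm_le.trans h1
  rw [← ofReal_norm, ← ofReal_norm, ← ENNReal.ofReal_mul (abs_nonneg C)] at h2
  exact (ENNReal.ofReal_le_ofReal_iff (by positivity)).1 h2

theorem IsApply.inner_eq {A : Observable H} {f : ℝ → ℝ} (hf : IsBoundedBorel f) {ψ v : H}
    (hv : A.IsApply f ψ v) : inner ℂ ψ v = ((∫ x, f x ∂(A.spectralMeasure ψ) : ℝ) : ℂ) := by
  rw [← sub_eq_zero]
  set μ := A.spectralMeasure ψ with hμ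
  have hb : ∀ g : ℝ → ℝ, Continuous g →
      ‖inner ℂ ψ v - ((∫ x, f x ∂μ : ℝ) : ℂ)‖ₑ ≤ ‖ψ‖ₑ * eLpNorm (f - g) 2 μ +
        ‖ψ‖ₑ * eLpNorm (f - g) 2 μ := by
    intro g hg
    have hgi : ∫ x, g x ∂μ = (inner ℂ ψ (cfc g A.op ψ)).re := A.integral_spectralMeasure ψ hg
    have hs : IsSelfAdjoint (cfc g A.op) := cfc_predicate g A.op
    have hgi' : inner ℂ ψ (cfc g A.op ψ) = ((∫ x, g x ∂μ : ℝ) : ℂ) := by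
      rw [hgi]
      exact (hs.isSymmetric.coe_re_inner_self_apply ψ).symm
    have e : inner ℂ ψ v - ((∫ x, f x ∂μ : ℝ) : ℂ) = inner ℂ ψ (v - cfc g A.op ψ) -
        ((∫ x, (f - g) x ∂μ : ℝ) : ℂ) := by
      have : ∫ x, (f - g) x ∂μ = ∫ x, f x ∂μ - ∫ x, g x ∂μ :=
        integral_sub ((hf.memLp 1 μ).integrable le_rfl)
          ((A.memLp_of_continuous ψ hg 1).integrable le_rfl)
      rw [this, inner_sub_right, hgi']
      push_cast
      ring
    rw [e]
    refine enorm_sub_le.trans (add_le_add ?_ ?_)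
    · refine le_trans ?_ (mul_le_mul_right (hv g hg) _)
      rw [← ofReal_norm, ← ofReal_norm, ← ofReal_norm, ← ENNReal.ofReal_mul (norm_nonneg _)]
      exact ENNReal.ofReal_le_ofReal (norm_inner_le_norm _ _)
    · have e1 : ‖((∫ x, (f - g) x ∂μ : ℝ) : ℂ)‖ₑ = ‖∫ x, (f - g) x ∂μ‖ₑ := by
        rw [← ofReal_norm, ← ofReal_norm, Complex.norm_real]
      rw [e1]
      refine (enorm_integral_le_lintegral_enorm _).trans ?_
      have hm : AEStronglyMeasurable (f - g) μ :=
        hf.1.aestronglyMeasurable.sub hg.aestronglyMeasurable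
      rw [← eLpNorm_one_eq_lintegral_enorm]
      refine (eLpNorm_le_eLpNorm_mul_rpow_measure_univ (q := 2) (by norm_num) hm).trans ?_
      rw [mul_comm]
      gcongr
      rw [← A.eLpNorm_const_one ψ, eLpNorm_const' _ (by norm_num) (by norm_num), ← hμ]
      norm_num
  refine A.eq_zero_of_approx hf ψ ψ ψ _ ‖ψ‖ₑ (by simp) fun g hg => (hb g hg).trans ?_
  rw [mul_add, mul_add]
  exact le_self_add

theorem eLpNorm_mul_le {μ : Measure ℝ} {f h : ℝ → ℝ} {C : ℝ} (hC : ∀ᵐ x ∂μ, |f x| ≤ C) :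
    eLpNorm (f * h) 2 μ ≤ ENNReal.ofReal C * eLpNorm h 2 μ := by
  refine eLpNorm_le_mul_eLpNorm_of_ae_le_mul ?_ 2
  filter_upwards [hC] with x hx
  simpa using mul_le_mul_of_nonneg_right hx (abs_nonneg (h x))

theorem isApply_mul (A : Observable H) {f h : ℝ → ℝ} (hf : IsBoundedBorel f)
    (hh : IsBoundedBorel h) {S T U : H →L[ℂ] H} (hS : ∀ ψ, A.IsApply f ψ (S ψ))
    (hT : ∀ ψ, A.IsApply h ψ (T ψ)) (hU : ∀ ψ, A.IsApply (f * h) ψ (U ψ)) : S * T = U := by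
  ext ψ
  change S (T ψ) = U ψ
  rw [← sub_eq_zero]
  obtain ⟨C, hC⟩ := hf.2
  set N := fun (χ : H) (u : ℝ → ℝ) => eLpNorm u 2 (A.spectralMeasure χ) with hN
  refine A.eq_zero_of_approx hh ψ ψ ψ _ (‖S‖ₑ + ENNReal.ofReal C) (by simp) fun g hg => ?_
  obtain ⟨G, hG⟩ := (spectrum.isCompact (𝕜 := ℝ) A.op).exists_bound_of_continuousOn
    hg.continuousOn
  have main : ‖S (T ψ) - U ψ‖ₑ ≤ (‖S‖ₑ + ENNReal.ofReal C) * N ψ (h - g) := by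
    refine A.le_of_approx hf (cfc g A.op ψ) ψ ψ _ _ (1 + ENNReal.ofReal G) (by simp)
      fun k hk => ?_
    have e : S (T ψ) - U ψ = S (T ψ - cfc g A.op ψ) +
        ((S (cfc g A.op ψ) - cfc k A.op (cfc g A.op ψ)) -
          (U ψ - cfc (fun x => k x * g x) A.op ψ)) := by
      rw [cfc_mul k g A.op hk.continuousOn hg.continuousOn, map_sub]
      change _ = S (T ψ) - S (cfc g A.op ψ) +
        ((S (cfc g A.op ψ) - cfc k A.op (cfc g A.op ψ)) - (U ψ - cfc k A.op (cfc g A.op ψ)))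
      abel
    have h1 : ‖S (T ψ - cfc g A.op ψ)‖ₑ ≤ ‖S‖ₑ * N ψ (h - g) :=
      (S.le_opENorm _).trans (mul_le_mul_right (hT ψ g hg) _)
    have h2 := hS (cfc g A.op ψ) k hk
    have h3 : ‖U ψ - cfc (fun x => k x * g x) A.op ψ‖ₑ ≤
        ENNReal.ofReal C * N ψ (h - g) + ENNReal.ofReal G * N ψ (f - k) := by
      refine (hU ψ _ (hk.mul hg)).trans ?_
      have e2 : f * h - k * g = f * (h - g) + g * (f - k) := by
        ext x
        simp only [Pi.sub_apply, Pi.mul_apply, Pi.add_apply]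
        ring
      have hfm := hf.1.aestronglyMeasurable (μ := A.spectralMeasure ψ)
      have hhm := hh.1.aestronglyMeasurable (μ := A.spectralMeasure ψ)
      have hgm := hg.aestronglyMeasurable (μ := A.spectralMeasure ψ)
      have hkm := hk.aestronglyMeasurable (μ := A.spectralMeasure ψ)
      rw [e2]
      refine (eLpNorm_add_le (hfm.mul (hhm.sub hgm)) (hgm.mul (hfm.sub hkm))
        (by norm_num)).trans (add_le_add ?_ ?_)
      · exact eLpNorm_mul_le (Filter.Eventually.of_forall hC)
      · refine eLpNorm_mul_le ?_
        filter_upwards [A.ae_mem_spectrum ψ] with x hx using hG x hx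
    rw [e]
    calc _ ≤ ‖S‖ₑ * N ψ (h - g) + (N (cfc g A.op ψ) (f - k) +
          (ENNReal.ofReal C * N ψ (h - g) + ENNReal.ofReal G * N ψ (f - k))) :=
        (enorm_add_le _ _).trans (add_le_add h1 (enorm_sub_le.trans (add_le_add h2 h3)))
      _ = (‖S‖ₑ + ENNReal.ofReal C) * N ψ (h - g) + (N (cfc g A.op ψ) (f - k) +
          ENNReal.ofReal G * N ψ (f - k)) := by ring
      _ ≤ _ := by
        gcongr
        rw [add_mul, one_mul]
        refine add_le_add ?_ ?_
        · rw [add_assoc]; exact le_self_add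
        · gcongr
          exact le_add_self
  refine main.trans ?_
  gcongr
  exact le_add_self

theorem existsUnique_borelFun (A : Observable H) {f : ℝ → ℝ} (hf : IsBoundedBorel f) :
    ∃! T : H →L[ℂ] H, ∀ ψ, inner ℂ ψ (T ψ) = ((∫ x, f x ∂(A.spectralMeasure ψ) : ℝ) : ℂ) := by
  obtain ⟨T, hT⟩ := A.exists_borelOp hf
  refine ⟨T, fun ψ => (hT ψ).inner_eq hf, fun S hS => ?_⟩
  apply ContinuousLinearMap.coe_injective
  rw [← ext_inner_map]
  intro ψ
  have := (hS ψ).trans ((hT ψ).inner_eq hf).symm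
  change inner ℂ (S ψ) ψ = inner ℂ (T ψ) ψ
  rw [← inner_conj_symm, this, inner_conj_symm]

/-- The operator `f(A) = ∫ f(λ) dE^A_λ` for a bounded Borel function `f`: the unique operator with
`⟨ψ, f(A) ψ⟩ = ∫ f(λ) d⟨ψ, E^A_λ ψ⟩` for all `ψ` (by polarization this determines the matrix
elements `⟨ψ, f(A) φ⟩`). Only the values of `f` on the spectrum of `A` matter. -/
noncomputable def borelFun (A : Observable H) (f : ℝ → ℝ) (hf : IsBoundedBorel f) : H →L[ℂ] H :=
  (A.existsUnique_borelFun hf).choose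

theorem inner_borelFun (A : Observable H) {f : ℝ → ℝ} (hf : IsBoundedBorel f) (ψ : H) :
    inner ℂ ψ (A.borelFun f hf ψ) = ((∫ x, f x ∂(A.spectralMeasure ψ) : ℝ) : ℂ) :=
  (A.existsUnique_borelFun hf).choose_spec.1 ψ

theorem isApply_borelFun (A : Observable H) {f : ℝ → ℝ} (hf : IsBoundedBorel f) (ψ : H) :
    A.IsApply f ψ (A.borelFun f hf ψ) := by
  obtain ⟨T, hT⟩ := A.exists_borelOp hf
  rw [show A.borelFun f hf = T from (A.existsUnique_borelFun hf).unique (A.inner_borelFun hf)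
    fun ψ => (hT ψ).inner_eq hf]
  exact hT ψ

theorem borelFun_mul (A : Observable H) {f h : ℝ → ℝ} (hf : IsBoundedBorel f)
    (hh : IsBoundedBorel h) :
    A.borelFun f hf * A.borelFun h hh = A.borelFun (f * h) (hf.mul hh) :=
  A.isApply_mul hf hh (A.isApply_borelFun hf) (A.isApply_borelFun hh)
    (A.isApply_borelFun (hf.mul hh))

theorem isSelfAdjoint_borelFun (A : Observable H) {f : ℝ → ℝ} (hf : IsBoundedBorel f) :
    IsSelfAdjoint (A.borelFun f hf) := by
  rw [ContinuousLinearMap.isSelfAdjoint_iff_isSymmetric, LinearMap.isSymmetric_iff_inner_map_self_real]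
  intro ψ
  have h := A.inner_borelFun hf ψ
  change (starRingEnd ℂ) (inner ℂ (A.borelFun f hf ψ) ψ) = inner ℂ (A.borelFun f hf ψ) ψ
  rw [inner_conj_symm, ← inner_conj_symm (A.borelFun f hf ψ) ψ, h, Complex.conj_ofReal]

theorem inner_borelFun_pow (A : Observable H) {f : ℝ → ℝ} (hf : IsBoundedBorel f) (n : ℕ)
    (ψ : H) : inner ℂ ψ ((A.borelFun f hf ^ n) ψ) =
      ((∫ x, f x ^ n ∂(A.spectralMeasure ψ) : ℝ) : ℂ) := by
  have key : A.borelFun f hf ^ n = A.borelFun (f ^ n) (hf.pow n) := by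
    induction n with
    | zero =>
      refine (A.existsUnique_borelFun (hf.pow 0)).unique (fun ψ => ?_) (A.inner_borelFun _)
      have h := A.integral_spectralMeasure ψ (g := fun _ => 1) continuous_const
      rw [cfc_const_one ℝ A.op A.isSelfAdjoint] at h
      have e : ∀ x, (f ^ 0) x = 1 := fun x => by simp
      simp only [e]
      rw [h]
      simp [inner_self_eq_norm_sq_to_K, ← Complex.ofReal_pow]
    | succ n ih =>
      rw [pow_succ, ih, borelFun_mul]
      congr 1
  rw [key, inner_borelFun]
  rfl

theorem ext_of_moments {μ ν : Measure ℝ} [IsFiniteMeasure μ] [IsFiniteMeasure ν] {R : ℝ}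
    (hμ : ∀ᵐ x ∂μ, x ∈ Set.Icc (-R) R) (hν : ∀ᵐ x ∂ν, x ∈ Set.Icc (-R) R)
    (h : ∀ n : ℕ, ∫ x, x ^ n ∂μ = ∫ x, x ^ n ∂ν) : μ = ν := by
  have cint : ∀ (ρ : Measure ℝ) [IsFiniteMeasure ρ], (∀ᵐ x ∂ρ, x ∈ Set.Icc (-R) R) →
      ∀ g : ℝ → ℝ, Continuous g → Integrable g ρ := by
    intro ρ _ hρ g hg
    obtain ⟨C, hC⟩ := (isCompact_Icc (a := -R) (b := R)).exists_bound_of_continuousOn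
      hg.continuousOn
    refine Integrable.of_bound hg.aestronglyMeasurable C ?_
    filter_upwards [hρ] with x hx using hC x hx
  have hp : ∀ p : Polynomial ℝ, ∫ x, p.eval x ∂μ = ∫ x, p.eval x ∂ν := by
    intro p
    simp only [Polynomial.eval_eq_sum_range]
    rw [integral_finsetSum _ fun n _ => cint μ hμ _ (by fun_prop),
      integral_finsetSum _ fun n _ => cint ν hν _ (by fun_prop)]
    simp only [integral_const_mul, h]
  refine ext_of_forall_integral_eq_of_IsFiniteMeasure fun u => ?_
  rw [← sub_eq_zero, ← abs_eq_zero]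
  refine le_antisymm (le_of_forall_pos_le_add fun ε hε => ?_) (abs_nonneg _)
  set m := μ.real Set.univ + ν.real Set.univ + 1 with hm
  have hmpos : 0 < m := by positivity
  obtain ⟨p, hpu⟩ := exists_polynomial_near_of_continuousOn (-R) R u u.continuous.continuousOn
    (ε / m) (by positivity)
  have bd : ∀ (ρ : Measure ℝ) [IsFiniteMeasure ρ], (∀ᵐ x ∂ρ, x ∈ Set.Icc (-R) R) →
      |∫ x, u x ∂ρ - ∫ x, p.eval x ∂ρ| ≤ ε / m * ρ.real Set.univ := by
    intro ρ _ hρ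
    rw [← integral_sub (cint ρ hρ _ u.continuous) (cint ρ hρ _ p.continuous)]
    rw [← Real.norm_eq_abs]
    refine norm_integral_le_of_norm_le_const ?_
    filter_upwards [hρ] with x hx
    rw [Real.norm_eq_abs, abs_sub_comm]
    exact (hpu x hx).le
  have h1 := bd μ hμ
  have h2 := bd ν hν
  rw [hp p] at h1
  have h3 : |∫ x, u x ∂μ - ∫ x, u x ∂ν| ≤ ε / m * μ.real Set.univ + ε / m * ν.real Set.univ := by
    rw [abs_le] at h1 h2 ⊢
    constructor <;> linarith [h1.1, h1.2, h2.1, h2.2]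
  have h4 : ε / m * μ.real Set.univ + ε / m * ν.real Set.univ ≤ ε := by
    have : ε / m * m = ε := by field_simp
    have h5 : 0 < ε / m := by positivity
    rw [hm, mul_add, mul_add] at this
    linarith
  rw [zero_add]
  exact h3.trans h4

theorem spectralMeasure_of_eq_borelFun (A B : Observable H) {f : ℝ → ℝ} (hf : IsBoundedBorel f)
    (hB : B.op = A.borelFun f hf) (ψ : H) :
    B.spectralMeasure ψ = (A.spectralMeasure ψ).map f := by
  obtain ⟨C, hC⟩ := hf.2
  obtain ⟨D, hD⟩ := (spectrum.isCompact (𝕜 := ℝ) B.op).exists_bound_of_continuousOn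
    continuous_id.continuousOn
  have hicc : ∀ {x r : ℝ}, |x| ≤ r → r ≤ max C D → x ∈ Set.Icc (-(max C D)) (max C D) :=
    fun h1 h2 => abs_le.1 (h1.trans h2)
  refine ext_of_moments (R := max C D) ?_ ?_ fun n => ?_
  · filter_upwards [B.ae_mem_spectrum ψ] with x hx using hicc (hD x hx) (le_max_right _ _)
  · refine (ae_map_iff hf.1.aemeasurable measurableSet_Icc).2 ?_
    exact Filter.Eventually.of_forall fun x => hicc (hC x) (le_max_left _ _)
  · rw [integral_map hf.1.aemeasurable (by fun_prop)]
    have h1 := B.integral_spectralMeasure ψ (g := fun x => x ^ n) (by fun_prop)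
    rw [cfc_pow_id B.op n B.isSelfAdjoint, hB, A.inner_borelFun_pow hf n ψ, Complex.ofReal_re] at h1
    exact h1

theorem eq_borelFun_id (A : Observable H) : ∃ f, ∃ hf : IsBoundedBorel f, A.op = A.borelFun f hf := by
  have hm : MeasurableSet (spectrum ℝ A.op) := (spectrum.isCompact A.op).measurableSet
  obtain ⟨D, hD⟩ := (spectrum.isCompact (𝕜 := ℝ) A.op).exists_bound_of_continuousOn
    continuous_id.continuousOn
  have hf : IsBoundedBorel ((spectrum ℝ A.op).indicator id) := by
    refine ⟨measurable_id.indicator hm, |D|, fun x => ?_⟩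
    by_cases hx : x ∈ spectrum ℝ A.op
    · rw [Set.indicator_of_mem hx]
      exact (hD x hx).trans (le_abs_self D)
    · rw [Set.indicator_of_notMem hx]
      simp
  refine ⟨_, hf, (A.existsUnique_borelFun hf).unique (fun ψ => ?_) (A.inner_borelFun hf)⟩
  have h1 := A.integral_spectralMeasure ψ continuous_id
  rw [cfc_id ℝ A.op A.isSelfAdjoint] at h1
  have h2 : ∫ x, (spectrum ℝ A.op).indicator id x ∂(A.spectralMeasure ψ) =
      ∫ x, id x ∂(A.spectralMeasure ψ) := by
    refine integral_congr_ae ?_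
    filter_upwards [A.ae_mem_spectrum ψ] with x hx using Set.indicator_of_mem hx _
  rw [h2, h1]
  exact (A.isSelfAdjoint.isSymmetric.coe_re_inner_self_apply ψ).symm

/-- The category `𝒪`. There is a morphism `f_𝒪 : B ⟶ A` if `B = f(A)` for some Borel function `f`, and
there is at most one, because `f` counts only up to the equivalence `f(A) = g(A)`. So `𝒪` is the
preorder below, and Mathlib regards every preorder as a category. -/
instance : Preorder (Observable H) where
  le B A := ∃ f, ∃ hf : IsBoundedBorel f, B.op = A.borelFun f hf
  le_refl A := A.eq_borelFun_id
  le_trans C B A := by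
    rintro ⟨g, hg, hC⟩ ⟨f, hf, hB⟩
    have hgf : IsBoundedBorel (g ∘ f) :=
      ⟨hg.1.comp hf.1, hg.2.choose, fun x => hg.2.choose_spec (f x)⟩
    refine ⟨g ∘ f, hgf, (A.existsUnique_borelFun hgf).unique (fun ψ => ?_) (A.inner_borelFun hgf)⟩
    rw [hC, B.inner_borelFun hg, A.spectralMeasure_of_eq_borelFun B hf hB,
      integral_map hf.1.aemeasurable hg.1.aestronglyMeasurable]
    rfl

end Observable

variable {H : Type u} [NormedAddCommGroup H] [InnerProductSpace ℂ H] [CompleteSpace H]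

variable (H) in
/-- The projection operators on `H`, with the order `P ≤ Q` of operators. -/
abbrev Projector : Type u := {P : H →L[ℂ] H // IsStarProjection P}

theorem isClosed_iInf_range (S : Set (Projector H)) :
    IsClosed ((⨅ P ∈ S, (P.1.range : Submodule ℂ H) : Submodule ℂ H) : Set H) := by
  simp only [Submodule.coe_iInf]
  refine isClosed_iInter fun P => isClosed_iInter fun _ => ?_
  exact ContinuousLinearMap.IsIdempotentElem.isClosed_range P.2.1

/-- The infimum in the lattice of projectors: the projector onto the intersection of the ranges. -/
noncomputable instance : InfSet (Projector H) where
  sInf S :=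
    haveI : CompleteSpace (⨅ P ∈ S, (P.1.range : Submodule ℂ H) : Submodule ℂ H) :=
      (isClosed_iInf_range S).completeSpace_coe
    ⟨(⨅ P ∈ S, (P.1.range : Submodule ℂ H)).starProjection, isStarProjection_starProjection⟩

theorem Projector.le_iff_range_le (P Q : Projector H) : P ≤ Q ↔ P.1.range ≤ Q.1.range := by
  obtain ⟨_, hP⟩ := isStarProjection_iff_eq_starProjection_range.1 P.2
  obtain ⟨_, hQ⟩ := isStarProjection_iff_eq_starProjection_range.1 Q.2
  rw [← Subtype.coe_le_coe]
  conv_lhs => rw [hP, hQ]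
  exact Submodule.starProjection_le_starProjection_iff

theorem Projector.isGLB_sInf (S : Set (Projector H)) : IsGLB S (sInf S) := by
  have hr : (sInf S : Projector H).1.range = ⨅ P ∈ S, (P.1.range : Submodule ℂ H) := by
    have : CompleteSpace (⨅ P ∈ S, (P.1.range : Submodule ℂ H) : Submodule ℂ H) :=
      (isClosed_iInf_range S).completeSpace_coe
    exact Submodule.range_starProjection _
  constructor
  · intro P hP
    rw [Projector.le_iff_range_le, hr]
    exact iInf₂_le P hP
  · intro Q hQ
    rw [Projector.le_iff_range_le, hr]
    exact le_iInf₂ fun P hP => (Projector.le_iff_range_le _ _).1 (hQ hP)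

namespace Observable

/-- The Borel subsets `Δ` of the spectrum of `A`; each stands for the proposition `A ∈ Δ`. -/
abbrev BorelSubset (A : Observable H) : Type :=
  {Δ : Set ℝ // MeasurableSet Δ ∧ Δ ⊆ spectrum ℝ A.op}

theorem isBoundedBorel_indicator {Δ : Set ℝ} (hΔ : MeasurableSet Δ) :
    IsBoundedBorel (Δ.indicator 1) := by
  refine ⟨measurable_one.indicator hΔ, 1, fun x => ?_⟩
  by_cases hx : x ∈ Δ <;> simp [hx]

/-- The spectral projector `E[A ∈ Δ] = ∫_Δ dE^A_λ`. -/
noncomputable def proj (A : Observable H) (Δ : A.BorelSubset) : Projector H :=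
  ⟨A.borelFun (Δ.1.indicator 1) (isBoundedBorel_indicator Δ.2.1), by
    refine ⟨?_, A.isSelfAdjoint_borelFun _⟩
    rw [IsIdempotentElem, borelFun_mul]
    congr 1
    ext x
    by_cases hx : x ∈ Δ.1 <;> simp [hx]⟩

/-- The spectral algebra `W_A`: all projectors `E[A ∈ Δ]`. -/
def spectralAlgebra (A : Observable H) : Set (Projector H) := Set.range A.proj

/-- `E[A ∈ Δ]` as an element of `W_A`. -/
noncomputable def specProj (A : Observable H) (Δ : A.BorelSubset) : A.spectralAlgebra :=
  ⟨A.proj Δ, Δ, rfl⟩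

/-- The empty set as a Borel subset of the spectrum: the null proposition. -/
def emptySubset (A : Observable H) : A.BorelSubset :=
  ⟨∅, MeasurableSet.empty, Set.empty_subset _⟩

/-- The whole spectrum as a Borel subset of itself: the unit proposition. -/
def fullSubset (A : Observable H) : A.BorelSubset :=
  ⟨spectrum ℝ A.op, (spectrum.isCompact A.op).measurableSet, subset_rfl⟩

end Observable

open Observable

/-- Coarse-graining of a projector `P` along a morphism into an algebra `W_B`:
`inf {Q ∈ W_B | P ≤ Q}`, the infimum being taken in the lattice of all projectors. -/
noncomputable def coarseGrain {A B : Observable H} (_f : B ⟶ A) (P : Projector H) : Projector H :=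
  sInf {Q | Q ∈ B.spectralAlgebra ∧ P ≤ Q}

/-- The projector `E[B ∈ f(Δ)]` for a morphism `f_𝒪 : B ⟶ A`, i.e. `B = f(A)`, by definition
`inf {E[B ∈ K] | K Borel, E[A ∈ Δ] ≤ E[B ∈ K]}`. This makes sense whether or not `f(Δ)` is Borel, and
it depends on `f` through its equivalence class only. -/
noncomputable def imageProj {A B : Observable H} (f : B ⟶ A) (Δ : A.BorelSubset) : Projector H :=
  coarseGrain f (A.proj Δ)

/-- A generalized valuation on propositions: to each proposition `A ∈ Δ` a sieve on `A` in `𝒪`. The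
value at `h(A) ∈ h(Δ)` is the value at `h(A) ∈ J` for any Borel set `J` such that
`E[h(A) ∈ J] = E[h(A) ∈ h(Δ)]`; that there is such a `J`, and that the value does not depend on it, is
part of functional composition. -/
structure IsGeneralizedValuation (ν : ∀ A : Observable H, A.BorelSubset → Sieve A) : Prop where
  functional_composition : ∀ {A B : Observable H} (h : B ⟶ A) (Δ : A.BorelSubset),
    (∃ J : B.BorelSubset, B.proj J = imageProj h Δ) ∧
      ∀ J : B.BorelSubset, B.proj J = imageProj h Δ → ν B J = (ν A Δ).pullback h
  null : ∀ A : Observable H, ν A A.emptySubset = ⊥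
  monotone : ∀ (A : Observable H) (Δ₁ Δ₂ : A.BorelSubset), Δ₁.1 ⊆ Δ₂.1 → ν A Δ₁ ≤ ν A Δ₂
  exclusive : ∀ (A : Observable H) (Δ₁ Δ₂ : A.BorelSubset), Δ₁.1 ∩ Δ₂.1 = ∅ →
    ν A Δ₁ = ⊤ → ν A Δ₂ < ⊤

/-- The unit proposition condition `ν(A ∈ σ(A)) = true_A`. -/
def UnitCondition (ν : ∀ A : Observable H, A.BorelSubset → Sieve A) : Prop :=
  ∀ A : Observable H, ν A A.fullSubset = ⊤

/-- A generalized valuation in contextual form: maps `ν_A : W_A → Ω(A)`, where `Ω(A)` is the set of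
sieves on `A`. Functional composition includes that the coarse-graining maps `W_A` into `W_{h(A)}`. -/
structure IsContextualValuation (ν : ∀ A : Observable H, A.spectralAlgebra → Sieve A) : Prop where
  functional_composition : ∀ {A B : Observable H} (h : B ⟶ A) (P : A.spectralAlgebra),
    ∃ hP : coarseGrain h P.1 ∈ B.spectralAlgebra,
      ν B ⟨coarseGrain h P.1, hP⟩ = (ν A P).pullback h
  null : ∀ (A : Observable H) (P : A.spectralAlgebra), P.1.1 = 0 → ν A P = ⊥
  monotone : ∀ (A : Observable H) (P Q : A.spectralAlgebra), P.1 ≤ Q.1 → ν A P ≤ ν A Q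
  exclusive : ∀ (A : Observable H) (P Q : A.spectralAlgebra), P.1.1 * Q.1.1 = 0 →
    ν A P = ⊤ → ν A Q < ⊤

/-- The unit proposition condition `ν_A(1) = true_A`. -/
def ContextualUnitCondition (ν : ∀ A : Observable H, A.spectralAlgebra → Sieve A) : Prop :=
  ∀ (A : Observable H) (P : A.spectralAlgebra), P.1.1 = 1 → ν A P = ⊤

/-- The operator `T` has the trace `c`: `∑ ⟨bᵢ, T bᵢ⟩ = c` in every orthonormal (Hilbert) basis. -/
def HasTrace (T : H →L[ℂ] H) (c : ℂ) : Prop :=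
  ∀ (ι : Type u) (b : HilbertBasis ι ℂ H), HasSum (fun i => inner ℂ (b i) (T (b i))) c

variable (H) in
/-- Density matrices: positive operators of trace one. -/
structure DensityMatrix where
  /-- the underlying operator -/
  op : H →L[ℂ] H
  isPositive : op.IsPositive
  trace_one : HasTrace op 1

/-- `ν^ρ(A ∈ Δ) = {f_𝒪 : B ⟶ A | tr(ρ E[B ∈ f(Δ)]) = 1}`, as a collection of morphisms. -/
def densityArrows (ρ : DensityMatrix H) (A : Observable H) (Δ : A.BorelSubset) : Presieve A :=
  fun _ f => HasTrace (ρ.op * (imageProj f Δ).1) 1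

/-- `ν^ψ(A ∈ Δ) = {f_𝒪 : B ⟶ A | E[B ∈ f(Δ)] ψ = ψ}`, as a collection of morphisms. -/
def vectorArrows (ψ : H) (A : Observable H) (Δ : A.BorelSubset) : Presieve A :=
  fun _ f => (imageProj f Δ).1 ψ = ψ

end GenVal

open CategoryTheory GenVal

/-!
A state makes some propositions certain. The projectors it makes certain form an upper set that
contains `1` and no two orthogonal members, and this is all that matters about the state: the
coarse-grainings of a proposition that stay certain form a sieve, and these sieves satisfy
(i)-(iv) and the unit condition, because coarse-graining `P ↦ inf {Q ∈ W_B | P ≤ Q}` is a closure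
operator that is functorial in `B`.

The one analytic point is that the coarse-grained projector lies in `W_B` again. Since `H` is
separable, a finite measure `μ` has the null sets of `E^B`, and a finite measure `ν ≪ μ` has the
null sets of the measures `⟨P φ, E^B P φ⟩`. The set where `dν/dμ ≠ 0` then gives the least spectral
projector of `B` above `P`.

For a density matrix `ρ`, computing the trace in an orthonormal basis of eigenvectors of `P` shows
that `tr(ρ P) = 1` if and only if `ρ P = ρ`, from which the properties of the certain projectors are
read off; for `ρ = ‖ψ‖⁻² |ψ⟩⟨ψ|` the condition becomes `P ψ = ψ`.
-/

namespace GenVal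

open MeasureTheory InnerProductSpace TopologicalSpace

theorem exists_measurableSet_null_iff_inter_null {α : Type*} [MeasurableSpace α]
    {μ ν : Measure α} [ν.HaveLebesgueDecomposition μ] (h : ν ≪ μ) :
    ∃ S, MeasurableSet S ∧ ∀ K, ν K = 0 ↔ μ (S ∩ K) = 0 := by
  have hr : Measurable (ν.rnDeriv μ) := Measure.measurable_rnDeriv ν μ
  refine ⟨{x | ν.rnDeriv μ x ≠ 0}, (hr (measurableSet_singleton 0)).compl, fun K => ?_⟩
  rw [← withDensity_apply_eq_zero hr, Measure.withDensity_rnDeriv_eq ν μ h]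

theorem exists_hilbertBasis_mem_or_mem_orthogonal {𝕜 E : Type*} [RCLike 𝕜] [NormedAddCommGroup E]
    [InnerProductSpace 𝕜 E] [CompleteSpace E] (K : Submodule 𝕜 E) [CompleteSpace K] :
    ∃ (w : Set E) (b : HilbertBasis w 𝕜 E), ∀ i, b i ∈ K ∨ b i ∈ Kᗮ := by
  obtain ⟨s, c, -⟩ := exists_hilbertBasis 𝕜 K
  have hc : Orthonormal 𝕜 fun i => (c i : E) := c.orthonormal.comp_linearIsometry K.subtypeₗᵢ
  obtain ⟨w, b, hw, hb⟩ := hc.toSubtypeRange.exists_hilbertBasis_extension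
  refine ⟨w, b, fun i => or_iff_not_imp_left.2 fun hi => ?_⟩
  refine Submodule.orthogonalProjectionOnto_eq_zero_iff.1 (c.repr.map_eq_zero_iff.1 ?_)
  ext j
  have hcj : (c j : E) ∈ w := hw ⟨j, rfl⟩
  have hne : (⟨c j, hcj⟩ : w) ≠ i := by
    rintro rfl
    exact hi (by simp [hb])
  have horth : inner 𝕜 (c j : E) (b i) = 0 := by simpa [hb] using b.orthonormal.2 hne
  rw [c.repr_apply_apply, Submodule.inner_orthogonalProjectionOnto_eq_of_mem_left, horth]
  rfl

variable {H : Type u} [NormedAddCommGroup H] [InnerProductSpace ℂ H]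

theorem HasTrace.sub {S T : H →L[ℂ] H} {c d : ℂ} (hS : HasTrace S c) (hT : HasTrace T d) :
    HasTrace (S - T) (c - d) := fun ι b => by
  simpa only [sub_apply, inner_sub_right] using (hS ι b).sub (hT ι b)

theorem HasTrace.const_smul {T : H →L[ℂ] H} {c : ℂ} (hT : HasTrace T c) (a : ℂ) :
    HasTrace (a • T) (a * c) := fun ι b => by
  simpa only [smul_apply, inner_smul_right] using (hT ι b).mul_left a

theorem hasTrace_rankOne (x y : H) : HasTrace (rankOne ℂ x y) (inner ℂ y x) := fun ι b => by
  simpa only [rankOne_apply, inner_smul_right] using b.hasSum_inner_mul_inner y x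

variable [CompleteSpace H]

namespace Projector

theorem apply_apply (P : Projector H) (φ : H) : P.1 (P.1 φ) = P.1 φ :=
  congrArg (fun T : H →L[ℂ] H => T φ) P.2.1

theorem inner_apply_left (P : Projector H) (φ χ : H) : inner ℂ (P.1 φ) χ = inner ℂ φ (P.1 χ) := by
  rw [← ContinuousLinearMap.adjoint_inner_left, P.2.2.adjoint_eq]

theorem inner_self_apply (P : Projector H) (φ : H) :
    inner ℂ φ (P.1 φ) = ((‖P.1 φ‖ ^ 2 : ℝ) : ℂ) := by
  rw [← P.apply_apply, ← P.inner_apply_left, P.apply_apply, inner_self_eq_norm_sq_to_K]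
  norm_cast

theorem ext_norm {P Q : Projector H} (h : ∀ φ, ‖P.1 φ‖ = ‖Q.1 φ‖) : P = Q := by
  refine Subtype.ext (ContinuousLinearMap.coe_injective ((ext_inner_map _ _).1 fun φ => ?_))
  simp only [ContinuousLinearMap.coe_coe, P.inner_apply_left, Q.inner_apply_left,
    P.inner_self_apply, Q.inner_self_apply, h]

theorem norm_sub_apply_sq (P : Projector H) (φ : H) :
    ‖φ - P.1 φ‖ ^ 2 = ‖φ‖ ^ 2 - ‖P.1 φ‖ ^ 2 := by
  rw [norm_sub_sq (𝕜 := ℂ), P.inner_self_apply, RCLike.re_to_complex, Complex.ofReal_re]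
  ring

theorem le_iff_apply_apply_eq {P Q : Projector H} : P ≤ Q ↔ ∀ φ, Q.1 (P.1 φ) = P.1 φ :=
  (P.2.le_iff_mul_eq_right Q.2).trans ContinuousLinearMap.ext_iff

end Projector

namespace Observable

/-- The part of a Borel set `K` that lies in the spectrum of `A`, as a proposition about `A`. -/
def interSpectrum (A : Observable H) {K : Set ℝ} (hK : MeasurableSet K) : A.BorelSubset :=
  ⟨K ∩ spectrum ℝ A.op, hK.inter A.fullSubset.2.1, Set.inter_subset_right⟩

theorem spectralMeasure_inter_spectrum (A : Observable H) (φ : H) (K : Set ℝ) :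
    A.spectralMeasure φ (K ∩ spectrum ℝ A.op) = A.spectralMeasure φ K :=
  measure_inter_conull (A.spectralMeasure_compl_spectrum φ)

theorem norm_proj_apply_sq (A : Observable H) (Δ : A.BorelSubset) (φ : H) :
    ‖(A.proj Δ).1 φ‖ ^ 2 = (A.spectralMeasure φ).real Δ.1 := by
  have h := A.inner_borelFun (isBoundedBorel_indicator Δ.2.1) φ
  rw [integral_indicator_one Δ.2.1] at h
  exact_mod_cast ((A.proj Δ).inner_self_apply φ).symm.trans h

theorem norm_sq_eq_spectralMeasure_univ (A : Observable H) (φ : H) :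
    ‖φ‖ ^ 2 = (A.spectralMeasure φ).real Set.univ := by
  have h := A.inner_borelFun_pow isBoundedBorel_one 0 φ
  simp only [pow_zero, one_apply_eq_self, integral_const, smul_eq_mul, mul_one,
    inner_self_eq_norm_sq_to_K] at h
  exact Complex.ofReal_injective (by push_cast; exact h)

theorem proj_apply_eq_zero_iff (A : Observable H) (Δ : A.BorelSubset) (φ : H) :
    (A.proj Δ).1 φ = 0 ↔ A.spectralMeasure φ Δ.1 = 0 := by
  rw [← norm_eq_zero, ← sq_eq_zero_iff, norm_proj_apply_sq, measureReal_eq_zero_iff]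

theorem proj_apply_eq_self_iff (A : Observable H) (Δ : A.BorelSubset) (φ : H) :
    (A.proj Δ).1 φ = φ ↔ A.spectralMeasure φ Δ.1ᶜ = 0 := by
  rw [eq_comm, ← sub_eq_zero, ← norm_eq_zero, ← sq_eq_zero_iff, Projector.norm_sub_apply_sq,
    norm_proj_apply_sq, norm_sq_eq_spectralMeasure_univ, ← measureReal_compl Δ.2.1,
    measureReal_eq_zero_iff]

theorem proj_interSpectrum_apply_eq_zero_iff (A : Observable H) {K : Set ℝ} (hK : MeasurableSet K)
    (φ : H) : (A.proj (A.interSpectrum hK)).1 φ = 0 ↔ A.spectralMeasure φ K = 0 := by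
  rw [proj_apply_eq_zero_iff, ← A.spectralMeasure_inter_spectrum φ K]
  rfl

theorem proj_mul_proj (A : Observable H) (Δ Δ' : A.BorelSubset) :
    (A.proj Δ).1 * (A.proj Δ').1 = (A.proj (A.interSpectrum (Δ.2.1.inter Δ'.2.1))).1 := by
  have hσ : Δ.1 ∩ Δ'.1 ∩ spectrum ℝ A.op = Δ.1 ∩ Δ'.1 :=
    Set.inter_eq_left.2 (Set.inter_subset_left.trans Δ.2.2)
  refine (A.borelFun_mul (isBoundedBorel_indicator Δ.2.1)
    (isBoundedBorel_indicator Δ'.2.1)).trans ?_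
  simp only [proj, interSpectrum, hσ, Set.inter_indicator_one]

theorem spectralMeasure_proj_apply (A : Observable H) (Δ : A.BorelSubset) (φ : H) :
    A.spectralMeasure ((A.proj Δ).1 φ) = (A.spectralMeasure φ).restrict Δ.1 := by
  ext K hK
  have hmul := congrArg (fun T : H →L[ℂ] H => ‖T φ‖ ^ 2) (A.proj_mul_proj (A.interSpectrum hK) Δ)
  simp only [mul_apply_eq_comp, norm_proj_apply_sq, interSpectrum] at hmul
  have hset : K ∩ spectrum ℝ A.op ∩ Δ.1 ∩ spectrum ℝ A.op = K ∩ Δ.1 ∩ spectrum ℝ A.op := by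
    rw [Set.inter_right_comm K, Set.inter_assoc, Set.inter_self]
  rw [Measure.restrict_apply hK, ← A.spectralMeasure_inter_spectrum _ K,
    ← A.spectralMeasure_inter_spectrum _ (K ∩ Δ.1), ← hset]
  exact (measureReal_eq_measureReal_iff).1 hmul

theorem le_proj_iff (A : Observable H) (P : Projector H) (Δ : A.BorelSubset) :
    P ≤ A.proj Δ ↔ ∀ φ, A.spectralMeasure (P.1 φ) Δ.1ᶜ = 0 := by
  simp only [Projector.le_iff_apply_apply_eq, proj_apply_eq_self_iff]

theorem proj_le_proj_iff (A : Observable H) (Δ Δ' : A.BorelSubset) :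
    A.proj Δ ≤ A.proj Δ' ↔ ∀ φ, A.spectralMeasure φ (Δ.1 \ Δ'.1) = 0 := by
  simp only [le_proj_iff, spectralMeasure_proj_apply, Measure.restrict_apply Δ'.2.1.compl,
    Set.sdiff_eq, Set.inter_comm]

theorem proj_mono (A : Observable H) {Δ Δ' : A.BorelSubset} (h : Δ.1 ⊆ Δ'.1) :
    A.proj Δ ≤ A.proj Δ' :=
  (A.proj_le_proj_iff _ _).2 fun φ => by rw [Set.sdiff_eq_empty.2 h, measure_empty]

theorem proj_emptySubset (A : Observable H) : (A.proj A.emptySubset).1 = 0 := by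
  ext φ
  exact (A.proj_apply_eq_zero_iff _ φ).2 measure_empty

theorem proj_fullSubset (A : Observable H) : (A.proj A.fullSubset).1 = 1 := by
  ext φ
  exact (A.proj_apply_eq_self_iff _ φ).2 (A.spectralMeasure_compl_spectrum φ)

theorem proj_mul_proj_eq_zero (A : Observable H) {Δ Δ' : A.BorelSubset}
    (h : Δ.1 ∩ Δ'.1 = ∅) : (A.proj Δ).1 * (A.proj Δ').1 = 0 := by
  ext φ
  refine (A.proj_apply_eq_zero_iff Δ ((A.proj Δ').1 φ)).2 ?_
  rw [spectralMeasure_proj_apply, Measure.restrict_apply Δ.2.1, h, measure_empty]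

theorem proj_interSpectrum_preimage {A B : Observable H} {f : ℝ → ℝ} (hf : IsBoundedBorel f)
    (hB : B.op = A.borelFun f hf) (K : B.BorelSubset) :
    A.proj (A.interSpectrum (hf.1 K.2.1)) = B.proj K := by
  refine Projector.ext_norm fun φ => ?_
  rw [← sq_eq_sq₀ (norm_nonneg _) (norm_nonneg _), norm_proj_apply_sq, norm_proj_apply_sq,
    A.spectralMeasure_of_eq_borelFun B hf hB, map_measureReal_apply hf.1 K.2.1]
  exact congrArg ENNReal.toReal (A.spectralMeasure_inter_spectrum φ _)

theorem spectralAlgebra_subset_of_le {A B : Observable H} (h : B ≤ A) :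
    B.spectralAlgebra ⊆ A.spectralAlgebra := by
  obtain ⟨f, hf, hB⟩ := h
  rintro _ ⟨K, rfl⟩
  exact ⟨_, proj_interSpectrum_preimage hf hB K⟩

theorem exists_isFiniteMeasure_forall_null_iff (A : Observable H) {X : Type*} [TopologicalSpace X]
    [SeparableSpace X] {f : X → H} (hf : Continuous f) :
    ∃ μ : Measure ℝ, IsFiniteMeasure μ ∧
      ∀ K, MeasurableSet K → (μ K = 0 ↔ ∀ x, A.spectralMeasure (f x) K = 0) := by
  obtain ⟨s, hs, hd⟩ := exists_countable_dense X
  have : Countable s := hs.to_subtype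
  refine ⟨(Measure.sum fun x : s => A.spectralMeasure (f x)).toFinite, inferInstance,
    fun K hK => ?_⟩
  rw [toFinite_apply_eq_zero_iff, Measure.sum_apply_eq_zero]
  refine ⟨fun h x => ?_, fun h x => h x⟩
  have hc : Continuous fun x => (A.proj (A.interSpectrum hK)).1 (f x) := by fun_prop
  have hz : (fun x => (A.proj (A.interSpectrum hK)).1 (f x)) = fun _ => 0 :=
    hc.ext_on hd continuous_const fun x hx =>
      (A.proj_interSpectrum_apply_eq_zero_iff hK _).2 (h ⟨x, hx⟩)
  exact (A.proj_interSpectrum_apply_eq_zero_iff hK _).1 (congrFun hz x)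

theorem exists_forall_le_proj_iff_proj_le_proj [SeparableSpace H] (B : Observable H)
    (P : Projector H) : ∃ J, ∀ K, P ≤ B.proj K ↔ B.proj J ≤ B.proj K := by
  obtain ⟨μ, _, hμ⟩ := B.exists_isFiniteMeasure_forall_null_iff (continuous_id (X := H))
  obtain ⟨ν, _, hν⟩ := B.exists_isFiniteMeasure_forall_null_iff P.1.continuous
  have hac : ν ≪ μ := .mk fun K hK h => (hν K hK).2 fun φ => (hμ K hK).1 h (P.1 φ)
  obtain ⟨S, hS, hνS⟩ := exists_measurableSet_null_iff_inter_null hac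
  refine ⟨B.interSpectrum hS, fun K => ?_⟩
  have hJ (φ : H) : B.spectralMeasure φ ((B.interSpectrum hS).1 \ K.1) =
      B.spectralMeasure φ (S ∩ K.1ᶜ) := by
    rw [← B.spectralMeasure_inter_spectrum φ (S ∩ K.1ᶜ), Set.inter_right_comm]
    rfl
  rw [le_proj_iff, ← hν _ K.2.1.compl, hνS, hμ _ (hS.inter K.2.1.compl), proj_le_proj_iff]
  simp only [id, hJ]

end Observable

open Observable

section CoarseGrain

variable {A B C : Observable H}

theorem isGLB_coarseGrain (f : B ⟶ A) (P : Projector H) :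
    IsGLB {Q | Q ∈ B.spectralAlgebra ∧ P ≤ Q} (coarseGrain f P) :=
  Projector.isGLB_sInf _

theorem coarseGrain_le (f : B ⟶ A) {P Q : Projector H} (hQ : Q ∈ B.spectralAlgebra)
    (hPQ : P ≤ Q) : coarseGrain f P ≤ Q :=
  (isGLB_coarseGrain f P).1 ⟨hQ, hPQ⟩

theorem le_coarseGrain (f : B ⟶ A) (P : Projector H) : P ≤ coarseGrain f P :=
  (isGLB_coarseGrain f P).2 fun _ hQ => hQ.2

theorem coarseGrain_mono (f : B ⟶ A) {P Q : Projector H} (h : P ≤ Q) :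
    coarseGrain f P ≤ coarseGrain f Q :=
  (isGLB_coarseGrain f Q).2 fun _ hR => coarseGrain_le f hR.1 (h.trans hR.2)

theorem coarseGrain_eq_self (f : B ⟶ A) {P : Projector H} (hP : P ∈ B.spectralAlgebra) :
    coarseGrain f P = P :=
  le_antisymm (coarseGrain_le f hP le_rfl) (le_coarseGrain f P)

theorem coarseGrain_mem_spectralAlgebra [SeparableSpace H] (f : B ⟶ A) (P : Projector H) :
    coarseGrain f P ∈ B.spectralAlgebra := by
  obtain ⟨J, hJ⟩ := B.exists_forall_le_proj_iff_proj_le_proj P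
  have hleast : IsLeast {Q | Q ∈ B.spectralAlgebra ∧ P ≤ Q} (B.proj J) := by
    refine ⟨⟨⟨J, rfl⟩, (hJ J).2 le_rfl⟩, ?_⟩
    rintro _ ⟨⟨K, rfl⟩, hK⟩
    exact (hJ K).1 hK
  exact ⟨J, hleast.isGLB.unique (isGLB_coarseGrain f P)⟩

theorem coarseGrain_le_coarseGrain_comp (g : C ⟶ B) (f : B ⟶ A) (P : Projector H) :
    coarseGrain f P ≤ coarseGrain (g ≫ f) P :=
  (isGLB_coarseGrain (g ≫ f) P).2 fun _ hR =>
    coarseGrain_le f (spectralAlgebra_subset_of_le (leOfHom g) hR.1) hR.2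

theorem coarseGrain_coarseGrain (g : C ⟶ B) (f : B ⟶ A) (P : Projector H) :
    coarseGrain g (coarseGrain f P) = coarseGrain (g ≫ f) P := by
  refine le_antisymm ?_ (coarseGrain_mono g (le_coarseGrain f P))
  refine (isGLB_coarseGrain (g ≫ f) P).2 fun R hR => coarseGrain_le g hR.1 ?_
  exact coarseGrain_le f (spectralAlgebra_subset_of_le (leOfHom g) hR.1) hR.2

end CoarseGrain

/-- A set of projectors that can serve as the set of propositions made certain by a state. -/
structure IsCertaintySet (F : Set (Projector H)) : Prop where
  isUpperSet : IsUpperSet F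
  one_mem : ⟨1, .one _⟩ ∈ F
  mul_ne_zero : ∀ {P Q : Projector H}, P ∈ F → Q ∈ F → P.1 * Q.1 ≠ 0

/-- The sieve of the morphisms along which the coarse-graining of `P` belongs to the upper set `F`;
for the certainty set of a state this is the value at `P` of the valuation of that state. -/
def certaintySieve {F : Set (Projector H)} (hF : IsUpperSet F) (A : Observable H)
    (P : A.spectralAlgebra) : Sieve A where
  arrows _ f := coarseGrain f P.1 ∈ F
  downward_closed h g := hF (coarseGrain_le_coarseGrain_comp g _ _) h

theorem certaintySieve_eq_top_iff {F : Set (Projector H)} (hF : IsUpperSet F) (A : Observable H)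
    (P : A.spectralAlgebra) : certaintySieve hF A P = ⊤ ↔ P.1 ∈ F := by
  rw [← Sieve.id_mem_iff_eq_top]
  change coarseGrain (𝟙 A) P.1 ∈ F ↔ P.1 ∈ F
  rw [coarseGrain_eq_self _ P.2]

namespace IsCertaintySet

variable {F : Set (Projector H)}

theorem isContextualValuation [SeparableSpace H] (hF : IsCertaintySet F) :
    IsContextualValuation (certaintySieve hF.isUpperSet) where
  functional_composition {A B} h P := by
    refine ⟨coarseGrain_mem_spectralAlgebra h P.1, Sieve.ext fun C g => ?_⟩
    change coarseGrain g (coarseGrain h P.1) ∈ F ↔ coarseGrain (g ≫ h) P.1 ∈ F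
    rw [coarseGrain_coarseGrain]
  null A P hP := by
    refine le_bot_iff.1 fun B f hf => ?_
    have hle : P.1 ≤ B.proj B.emptySubset :=
      (P.1.2.le_iff_mul_eq_right (B.proj B.emptySubset).2).2 (by rw [hP, mul_zero])
    have h0 : B.proj B.emptySubset ∈ F := hF.isUpperSet (coarseGrain_le f ⟨_, rfl⟩ hle) hf
    exact hF.mul_ne_zero h0 h0 (by rw [proj_emptySubset, mul_zero])
  monotone A P Q h B f hf := hF.isUpperSet (coarseGrain_mono f h) hf
  exclusive A P Q h hP := by
    rw [certaintySieve_eq_top_iff] at hP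
    rw [lt_top_iff_ne_top, Ne, certaintySieve_eq_top_iff]
    exact fun hQ => hF.mul_ne_zero hP hQ h

theorem contextualUnitCondition (hF : IsCertaintySet F) :
    ContextualUnitCondition (certaintySieve hF.isUpperSet) := fun A P hP => by
  rw [certaintySieve_eq_top_iff, show P.1 = ⟨1, .one _⟩ from Subtype.ext hP]
  exact hF.one_mem

end IsCertaintySet

theorem IsContextualValuation.isGeneralizedValuation
    {ν : ∀ A : Observable H, A.spectralAlgebra → Sieve A} (hν : IsContextualValuation ν) :
    IsGeneralizedValuation (fun A Δ => ν A (A.specProj Δ)) where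
  functional_composition {A B} h Δ := by
    obtain ⟨hP, hfc⟩ := hν.functional_composition h (A.specProj Δ)
    refine ⟨hP, fun J hJ => ?_⟩
    rw [← hfc]
    exact congrArg (ν B) (Subtype.ext hJ)
  null A := hν.null A _ A.proj_emptySubset
  monotone A _ _ h := hν.monotone A _ _ (A.proj_mono h)
  exclusive A _ _ h := hν.exclusive A _ _ (A.proj_mul_proj_eq_zero h)

theorem ContextualUnitCondition.unitCondition
    {ν : ∀ A : Observable H, A.spectralAlgebra → Sieve A} (hν : ContextualUnitCondition ν) :
    UnitCondition (fun A Δ => ν A (A.specProj Δ)) :=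
  fun A => hν A _ A.proj_fullSubset

theorem isCertaintySet_mul_eq_self {T : H →L[ℂ] H} (hT : T ≠ 0) :
    IsCertaintySet {P : Projector H | T * P.1 = T} where
  isUpperSet P Q hPQ (hP : T * P.1 = T) := by
    have hmul : P.1 * Q.1 = P.1 := (P.2.le_iff_mul_eq_left Q.2).1 hPQ
    change T * Q.1 = T
    rw [← hP, mul_assoc, hmul]
  one_mem := mul_one T
  mul_ne_zero {P Q} (hP : T * P.1 = T) (hQ : T * Q.1 = T) h :=
    hT (by rw [← hQ, ← hP, mul_assoc, h, mul_zero])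

theorem Projector.exists_hilbertBasis_apply_eq (P : Projector H) :
    ∃ (w : Set H) (b : HilbertBasis w ℂ H), ∀ i, P.1 (b i) = b i ∨ P.1 (b i) = 0 := by
  have hclosed : IsClosed (P.1.range : Set H) :=
    ContinuousLinearMap.IsIdempotentElem.isClosed_range P.2.1
  have : CompleteSpace P.1.range := hclosed.completeSpace_coe
  obtain ⟨_, hP⟩ := isStarProjection_iff_eq_starProjection_range.1 P.2
  obtain ⟨w, b, hb⟩ := exists_hilbertBasis_mem_or_mem_orthogonal P.1.range
  refine ⟨w, b, fun i => ?_⟩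
  rw [hP, Submodule.starProjection_eq_self_iff, Submodule.starProjection_apply_eq_zero_iff]
  exact hb i

theorem apply_eq_zero_of_inner_eq_zero {T : H →L[ℂ] H} (hT : T.IsPositive) {x : H}
    (hx : inner ℂ x (T x) = 0) : T x = 0 := by
  rw [← ContinuousLinearMap.nonneg_iff_isPositive] at hT
  obtain ⟨S, rfl⟩ := CStarAlgebra.nonneg_iff_eq_star_mul_self.1 hT
  have hS : S x = 0 := by
    rw [← inner_self_eq_zero (𝕜 := ℂ), ← ContinuousLinearMap.adjoint_inner_right]
    exact hx
  rw [mul_apply_eq_comp, hS, map_zero]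

open scoped ComplexOrder in
theorem mul_projector_eq_zero_of_hasTrace_zero {T : H →L[ℂ] H} (hT : T.IsPositive)
    {P : Projector H} (h : HasTrace (T * P.1) 0) : T * P.1 = 0 := by
  obtain ⟨w, b, hb⟩ := P.exists_hilbertBasis_apply_eq
  have hterm (i : w) : inner ℂ (b i) ((T * P.1) (b i)) = inner ℂ (P.1 (b i)) (T (P.1 (b i))) := by
    rcases hb i with hi | hi <;> simp [hi]
  have hsum := h w b
  simp only [hterm] at hsum
  have hzero := (hasSum_zero_iff_of_nonneg fun i => hT.inner_nonneg_right _).1 hsum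
  refine ContinuousLinearMap.ext_on
    (Submodule.dense_iff_topologicalClosure_eq_top.2 b.dense_span) ?_
  rintro _ ⟨i, rfl⟩
  exact apply_eq_zero_of_inner_eq_zero hT (congrFun hzero i)

theorem hasTrace_mul_projector_iff {T : H →L[ℂ] H} (hT : T.IsPositive) {c : ℂ}
    (hc : HasTrace T c) (P : Projector H) : HasTrace (T * P.1) c ↔ T * P.1 = T := by
  refine ⟨fun h => ?_, fun h => by rwa [h]⟩
  have hcompl : HasTrace (T * (1 - P.1)) 0 := by
    simpa only [mul_sub, mul_one, sub_self] using hc.sub h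
  have hzero := mul_projector_eq_zero_of_hasTrace_zero hT (P := ⟨1 - P.1, P.2.one_sub⟩) hcompl
  rw [mul_sub, mul_one, sub_eq_zero] at hzero
  exact hzero.symm

namespace DensityMatrix

theorem op_ne_zero (ρ : DensityMatrix H) : ρ.op ≠ 0 := fun h => by
  obtain ⟨w, b, -⟩ := exists_hilbertBasis ℂ H
  have hsum := ρ.trace_one w b
  simp only [h, zero_apply, inner_zero_right] at hsum
  exact zero_ne_one (hasSum_zero.unique hsum)

theorem isCertaintySet (ρ : DensityMatrix H) :
    IsCertaintySet {P : Projector H | HasTrace (ρ.op * P.1) 1} := by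
  simpa only [hasTrace_mul_projector_iff ρ.isPositive ρ.trace_one]
    using isCertaintySet_mul_eq_self ρ.op_ne_zero

/-- The density matrix `‖ψ‖⁻² |ψ⟩⟨ψ|` of the pure state given by a non-zero vector `ψ`. -/
noncomputable def pure (ψ : H) (hψ : ψ ≠ 0) : DensityMatrix H where
  op := ((‖ψ‖ : ℂ) ^ 2)⁻¹ • rankOne ℂ ψ ψ
  isPositive := by
    refine (isPositive_rankOne_self ψ).smul_of_nonneg ?_
    rw [← Complex.ofReal_pow, ← Complex.ofReal_inv, Complex.zero_le_real]
    positivity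
  trace_one := by
    have hn : (‖ψ‖ : ℂ) ^ 2 ≠ 0 := by simpa using hψ
    have htrace := (hasTrace_rankOne ψ ψ).const_smul ((‖ψ‖ : ℂ) ^ 2)⁻¹
    rwa [inner_self_eq_norm_sq_to_K, RCLike.ofReal_eq_complex_ofReal, inv_mul_cancel₀ hn] at htrace

theorem hasTrace_pure_mul_iff {ψ : H} (hψ : ψ ≠ 0) (P : Projector H) :
    HasTrace ((pure ψ hψ).op * P.1) 1 ↔ P.1 ψ = ψ := by
  have hn : ((‖ψ‖ : ℂ) ^ 2)⁻¹ ≠ 0 := by simpa using hψ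
  have hpure : (pure ψ hψ).op * P.1 = (pure ψ hψ).op ↔
      rankOne ℂ ψ (P.1 ψ) = rankOne ℂ ψ ψ := by
    rw [pure, smul_mul_assoc, smul_right_inj hn, ContinuousLinearMap.mul_def, rankOne_comp,
      P.2.2.adjoint_eq]
  rw [hasTrace_mul_projector_iff (pure ψ hψ).isPositive (pure ψ hψ).trace_one, hpure,
    ← sub_eq_zero, ← map_sub, rankOne_eq_zero, or_iff_right hψ, sub_eq_zero]

theorem densityArrows_pure {ψ : H} (hψ : ψ ≠ 0) (A : Observable H) (Δ : A.BorelSubset) :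
    densityArrows (pure ψ hψ) A Δ = vectorArrows ψ A Δ := by
  funext B f
  exact propext (hasTrace_pure_mul_iff hψ _)

end DensityMatrix

end GenVal

theorem mainTheorem1 {H : Type*} [NormedAddCommGroup H] [InnerProductSpace ℂ H] [CompleteSpace H]
    [TopologicalSpace.SeparableSpace H] :
    (∀ ρ : DensityMatrix H, ∃ ν : ∀ A : Observable H, A.spectralAlgebra → Sieve A,
      (∀ (A : Observable H) (Δ : A.BorelSubset),
        (ν A (A.specProj Δ)).arrows = densityArrows ρ A Δ) ∧
      IsGeneralizedValuation (fun A Δ => ν A (A.specProj Δ)) ∧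
      UnitCondition (fun A Δ => ν A (A.specProj Δ)) ∧
      IsContextualValuation ν ∧ ContextualUnitCondition ν) ∧
    (∀ ψ : H, ψ ≠ 0 → ∃ ν : ∀ A : Observable H, A.spectralAlgebra → Sieve A,
      (∀ (A : Observable H) (Δ : A.BorelSubset),
        (ν A (A.specProj Δ)).arrows = vectorArrows ψ A Δ) ∧
      IsGeneralizedValuation (fun A Δ => ν A (A.specProj Δ)) ∧
      UnitCondition (fun A Δ => ν A (A.specProj Δ)) ∧
      IsContextualValuation ν ∧ ContextualUnitCondition ν ∧
      ∃ ρ : DensityMatrix H,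
        ρ.op = ((‖ψ‖ : ℂ) ^ 2)⁻¹ • InnerProductSpace.rankOne ℂ ψ ψ ∧
        ∀ (A : Observable H) (Δ : A.BorelSubset),
          densityArrows ρ A Δ = vectorArrows ψ A Δ) := by
  refine ⟨fun ρ => ?_, fun ψ hψ => ?_⟩
  · have hF := ρ.isCertaintySet
    exact ⟨certaintySieve hF.isUpperSet, fun _ _ => rfl,
      hF.isContextualValuation.isGeneralizedValuation, hF.contextualUnitCondition.unitCondition,
      hF.isContextualValuation, hF.contextualUnitCondition⟩
  · have hF := (DensityMatrix.pure ψ hψ).isCertaintySet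
    have harrows := DensityMatrix.densityArrows_pure hψ
    exact ⟨certaintySieve hF.isUpperSet, harrows,
      hF.isContextualValuation.isGeneralizedValuation, hF.contextualUnitCondition.unitCondition,
      hF.isContextualValuation, hF.contextualUnitCondition, DensityMatrix.pure ψ hψ, rfl, harrows⟩
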